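/- **Li–Yau inequality for $\mathscr P^{(a)}_t$.** Let $N\ge 2$ and let $Q,B$ be real $N\times N$ matrices with $Q=Q^*\ge 0$ such that $$K(t)=\frac1t\int_0^t e^{sB}Qe^{sB^*}\,ds>0\qquad\text{for every } t>0 .$$ Put $C(t)=\int_0^t e^{-sB}Qe^{-sB^*}\,ds$, $m_t(X,Y)=\langle K(t)^{-1}(Y-e^{tB}X),Y-e^{tB}X\rangle^{1/2}$, $V(t)=\omega_N(\det(tK(t)))^{1/2}$ ($\omega_N$ the volume of the unit ball of $\mathbb R^N$), and $$p(X,Y,t)=\frac{c_N}{V(t)}\exp\Big(-\frac{m_t(X,Y)^2}{4t}\Big),\qquad c_N^{-1}=4^{N/2}\,\Gamma\big(\tfrac N2+1\big).$$ For $a>-1$, $t>0$ and $z,\zeta>0$ let $$p^{(a)}(z,\zeta,t)=(2t)^{-\frac{a+1}{2}}\Big(\frac{z\zeta}{2t}\Big)^{\frac{1-a}{2}}I_{\frac{a-1}{2}}\Big(\frac{z\zeta}{2t}\Big)e^{-\frac{z^2+\zeta^2}{4t}},$$ where $I_\nu(x)=\sum_{k\ge0}\frac{(x/2)^{\nu+2k}}{k!\,\Gamma(\nu+k+1)}$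 is the modified Bessel function of the first kind, and define $p^{(a)}(0,\zeta,t)$ as the limit as $z\to0^+$, that is $$p^{(a)}(0,\zeta,t)=(2t)^{-\frac{a+1}{2}}\,\frac{2^{\frac{1-a}{2}}}{\Gamma(\frac{a+1}{2})}\,e^{-\frac{\zeta^2}{4t}} .$$ Let $\mathscr G^{(a)}(X,t,z;Y,\tau,\zeta)=p(X,Y,t-\tau)\,p^{(a)}(z,\zeta,t-\tau)$ and, for $X\in\mathbb R^N$, $t>0$, $z\ge0$, $$\mathscr P^{(a)}_t\varphi(X,z)=\int_0^\infty\int_{\mathbb R^N}\mathscr G^{(a)}(X,t,z;Y,0,\zeta)\,\varphi(Y,\zeta)\,\zeta^a\,dY\,d\zeta .$$ Let $\varphi\in C_0^\infty(\mathbb R^{N+1}_+)$, where $\mathbb R^{N+1}_+=\mathbb R^N\times(0,\infty)$, with $\varphi\ge0$ and $\varphi\not\equiv0$. Then: 1. For every $a\ge0$, $X\in\mathbb R^N$, $t>0$ and $z>0$ one has $\mathscr P^{(a)}_t\varphi(X,z)>0$, the function $u(X,t,z)=\log\mathscr P^{(a)}_t\varphi(X,z)$ is differentiable in $X$, in $t$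 and in $z$ at this point, and $$\langle Q\nabla_Xu,\nabla_Xu\rangle+(\partial_zu)^2+\langle BX,\nabla_Xu\rangle-\partial_tu<\tfrac12\operatorname{tr}\big(Q\,C(t)^{-1}\big)+\frac{a+1}{2t}.$$ 2. For every $a>-1$, $X\in\mathbb R^N$ and $t>0$ the same assertions hold at $z=0$, where $\partial_zu$ is the right derivative at $z=0$. -/

import Mathlib

open Set MeasureTheory
open scoped Matrix ContDiff

namespace ExtensionSemigroup

noncomputable section

/-- The covariance matrix `K(t) = (1/t) ∫₀ᵗ e^{sB} Q e^{sB*} ds` (integral taken entrywise). -/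
def covK {N : ℕ} (Q B : Matrix (Fin N) (Fin N) ℝ) (t : ℝ) : Matrix (Fin N) (Fin N) ℝ :=
  (1 / t) • Matrix.of fun i j =>
    ∫ s in (0 : ℝ)..t, (NormedSpace.exp (s • B) * Q * NormedSpace.exp (s • Bᵀ)) i j

/-- The matrix `C(t) = ∫₀ᵗ e^{-sB} Q e^{-sB*} ds` (integral taken entrywise). -/
def covC {N : ℕ} (Q B : Matrix (Fin N) (Fin N) ℝ) (t : ℝ) : Matrix (Fin N) (Fin N) ℝ :=
  Matrix.of fun i j =>
    ∫ s in (0 : ℝ)..t, (NormedSpace.exp (-s • B) * Q * NormedSpace.exp (-s • Bᵀ)) i j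

/-- The intertwined pseudo-distance
`m_t(X,Y) = ⟨K(t)⁻¹ (Y - e^{tB} X), Y - e^{tB} X⟩^{1/2}`. -/
def pseudoDist {N : ℕ} (Q B : Matrix (Fin N) (Fin N) ℝ) (t : ℝ)
    (X Y : EuclideanSpace ℝ (Fin N)) : ℝ :=
  let D : EuclideanSpace ℝ (Fin N) := Y - Matrix.toEuclideanLin (NormedSpace.exp (t • B)) X
  √(inner ℝ (Matrix.toEuclideanLin (covK Q B t)⁻¹ D) D)

/-- The volume function `V(t) = ω_N (det (t K(t)))^{1/2}`, with `ω_N` the volume of the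
Euclidean unit ball. -/
def volFun {N : ℕ} (Q B : Matrix (Fin N) (Fin N) ℝ) (t : ℝ) : ℝ :=
  (volume (Metric.ball (0 : EuclideanSpace ℝ (Fin N)) 1)).toReal * √((t • covK Q B t).det)

/-- The transition kernel `p(X,Y,t) = (c_N / V(t)) exp(- m_t(X,Y)² / (4t))`, where
`c_N⁻¹ = 4^{N/2} Γ(N/2 + 1)`. -/
def kernelP {N : ℕ} (Q B : Matrix (Fin N) (Fin N) ℝ)
    (X Y : EuclideanSpace ℝ (Fin N)) (t : ℝ) : ℝ :=
  ((4 : ℝ) ^ ((N : ℝ) / 2) * Real.Gamma ((N : ℝ) / 2 + 1))⁻¹ / volFun Q B t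
    * Real.exp (-(pseudoDist Q B t X Y) ^ 2 / (4 * t))

/-- The modified Bessel function of the first kind
`I_ν(x) = ∑ₖ (x/2)^{ν+2k} / (k! Γ(ν+k+1))`, for `x > 0`. -/
def besselI (ν x : ℝ) : ℝ :=
  ∑' k : ℕ, (x / 2) ^ (ν + 2 * (k : ℝ)) / ((k.factorial : ℝ) * Real.Gamma (ν + (k : ℝ) + 1))

/-- The kernel `p^{(a)}(z,ζ,t)` of the Bessel semigroup with Neumann condition. For `z ≠ 0` it
is given by the formula with the Bessel function `I_{(a-1)/2}`; at `z = 0` it is given by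
the limit as `z → 0⁺` of that formula, i.e. one replaces `x^{(1-a)/2} I_{(a-1)/2}(x)` by its limit
`2^{(1-a)/2} / Γ((a+1)/2)` as `x → 0⁺`. -/
def besselKernel (a z ζ t : ℝ) : ℝ :=
  if z = 0 then
    (2 * t) ^ (-(a + 1) / 2) * ((2 : ℝ) ^ ((1 - a) / 2) / Real.Gamma ((a + 1) / 2))
      * Real.exp (-ζ ^ 2 / (4 * t))
  else
    (2 * t) ^ (-(a + 1) / 2) * (z * ζ / (2 * t)) ^ ((1 - a) / 2)
      * besselI ((a - 1) / 2) (z * ζ / (2 * t)) * Real.exp (-(z ^ 2 + ζ ^ 2) / (4 * t))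

/-- The Neumann fundamental solution
`G^{(a)}(X,t,z;Y,τ,ζ) = p(X,Y,t-τ) p^{(a)}(z,ζ,t-τ)`. -/
def neumannG {N : ℕ} (Q B : Matrix (Fin N) (Fin N) ℝ) (a : ℝ)
    (X : EuclideanSpace ℝ (Fin N)) (t z : ℝ) (Y : EuclideanSpace ℝ (Fin N)) (τ ζ : ℝ) : ℝ :=
  kernelP Q B X Y (t - τ) * besselKernel a z ζ (t - τ)

/-- The extension semigroup
`P^{(a)}_t φ(X,z) = ∫₀^∞ ∫_{ℝ^N} G^{(a)}(X,t,z;Y,0,ζ) φ(Y,ζ) ζ^a dY dζ`. -/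
def extSemigroup {N : ℕ} (Q B : Matrix (Fin N) (Fin N) ℝ) (a : ℝ)
    (φ : EuclideanSpace ℝ (Fin N) × ℝ → ℝ) (t : ℝ) (X : EuclideanSpace ℝ (Fin N)) (z : ℝ) : ℝ :=
  ∫ ζ in Ioi (0 : ℝ), ∫ Y : EuclideanSpace ℝ (Fin N),
    neumannG Q B a X t z Y 0 ζ * φ (Y, ζ) * ζ ^ a

/-- The strict Li-Yau inequality for `u = log P^{(a)}_t φ` at the point `(X,t,z)`, `t > 0`, `z ≥ 0`:
`P^{(a)}_t φ(X,z) > 0`, the first derivatives of `u` exist, and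
`⟨Q∇_X u, ∇_X u⟩ + (∂_z u)² + ⟨BX, ∇_X u⟩ - ∂_t u < ½ tr(Q C(t)⁻¹) + (a+1)/(2t)`.
The `z`-derivative is relative to `[0,∞)`: it is the ordinary one if `z > 0` and the
right derivative if `z = 0` (so that `u` is in particular right continuous at `z = 0`). -/
def LiYauAt {N : ℕ} (Q B : Matrix (Fin N) (Fin N) ℝ) (a : ℝ)
    (φ : EuclideanSpace ℝ (Fin N) × ℝ → ℝ) (X : EuclideanSpace ℝ (Fin N)) (t z : ℝ) : Prop :=
  let u : EuclideanSpace ℝ (Fin N) → ℝ → ℝ → ℝ :=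
    fun X' t' z' => Real.log (extSemigroup Q B a φ t' X' z')
  let gradX : EuclideanSpace ℝ (Fin N) := gradient (fun X' => u X' t z) X
  let dz : ℝ := derivWithin (fun z' => u X t z') (Ici 0) z
  let dt : ℝ := deriv (fun t' => u X t' z) t
  0 < extSemigroup Q B a φ t X z ∧
  DifferentiableAt ℝ (fun X' => u X' t z) X ∧
  DifferentiableWithinAt ℝ (fun z' => u X t z') (Ici 0) z ∧
  DifferentiableAt ℝ (fun t' => u X t' z) t ∧
  inner ℝ (Matrix.toEuclideanLin Q gradX) gradX + dz ^ 2
      + inner ℝ (Matrix.toEuclideanLin B X) gradX - dt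
    < 1 / 2 * (Q * (covC Q B t)⁻¹).trace + (a + 1) / (2 * t)

end

end ExtensionSemigroup

/-!
The inequality holds pointwise for the logarithm of the kernel, and it passes to the average over
`(Y, ζ)` because its left-hand side is convex in the first derivatives.

*Gaussian factor.* With `M(t) = t K(t)`, so that `M' = e^{tB} Q e^{tB*}`, and
`w = ∇_X log p`, one has the identity
`⟨Q w, w⟩ + ⟨B X, w⟩ - ∂_t log p = ½ tr (M⁻¹ M') = ½ tr (Q C(t)⁻¹)`, the last step because
`M(t) = e^{tB} C(t) e^{tB*}` (`gram_eq_conj_covC`, `trace_inv_gram_mul`).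

*Bessel factor.* Put `ν = (a-1)/2`. Then `x^{-ν} I_ν(x) = F_ν(x²)` with `F_ν` entire, so that the
kernel is the restriction to `z ≥ 0` of a function smooth in all variables, even across `z = 0`.
With `x = zζ/(2t)` and `r = I_{ν+1}(x) / I_ν(x)`,
`(∂_z log p^{(a)})² - ∂_t log p^{(a)} = (a+1)/(2t) + ζ² (r² - 1) / (4t²)`.
At `z = 0` one has `r = 0`. For `z > 0` and `a ≥ 0`, that is `ν ≥ -1/2`, one has `r < 1`, because
`F_ν² - s F_{ν+1}²` has the derivative `(2ν+1) F_{ν+1}² ≥ 0` in `s` and is positive at `s = 0`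
(`mul_besselEntire_sq_lt`).

*Averaging.* Let `v = ∇_X u` and `b = ∂_z u` be the derivatives of the logarithm `u` of the
semigroup at the given point. By `⟨Q w, w⟩ ≥ 2 ⟨Q w, v⟩ - ⟨Q v, v⟩` and `β² ≥ 2 b β - b²`, the
pointwise inequality bounds the derivative of the kernel in the single direction
`(2 Q v + B X, -1, 2 b)` of `(X, t, z)`-space by a constant times the kernel
(`fderivFst_extKernel_lt`). Differentiation under the integral sign turns this into the same bound
for the semigroup, which is the assertion.
-/

namespace ExtensionSemigroup

/-! ### The entire function behind the modified Bessel function -/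

/-- Coefficients of `besselEntire`. -/
noncomputable def besselCoeff (ν : ℝ) (k : ℕ) : ℝ :=
  (2 : ℝ) ^ (-ν) / (4 ^ k * (k.factorial : ℝ) * Real.Gamma (ν + k + 1))

/-- The entire function `F_ν` with `x ^ (-ν) * I_ν x = F_ν (x ^ 2)` for `x > 0`. -/
noncomputable def besselEntire (ν s : ℝ) : ℝ := ∑' k : ℕ, besselCoeff ν k * s ^ k

lemma besselCoeff_pos {ν : ℝ} (hν : -1 < ν) (k : ℕ) : 0 < besselCoeff ν k := by
  have hk : (0 : ℝ) ≤ k := Nat.cast_nonneg k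
  have : 0 < Real.Gamma (ν + k + 1) := Real.Gamma_pos_of_pos (by linarith)
  unfold besselCoeff
  positivity

lemma besselCoeff_succ {ν : ℝ} (hν : -1 < ν) (k : ℕ) :
    (4 * (k + 1) * (ν + k + 1)) * besselCoeff ν (k + 1) = besselCoeff ν k := by
  have hk : (0 : ℝ) ≤ k := Nat.cast_nonneg k
  have hpos : 0 < ν + k + 1 := by linarith
  have hG : Real.Gamma (ν + k + 1) ≠ 0 := (Real.Gamma_pos_of_pos hpos).ne'
  have hrec : Real.Gamma (ν + ((k + 1 : ℕ) : ℝ) + 1) = (ν + k + 1) * Real.Gamma (ν + k + 1) := by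
    rw [← Real.Gamma_add_one hpos.ne']
    congr 1
    push_cast
    ring
  have hfac : (k.factorial : ℝ) ≠ 0 := by positivity
  have hpos' := hpos.ne'
  unfold besselCoeff
  rw [hrec, Nat.factorial_succ]
  push_cast
  have : (k : ℝ) + 1 ≠ 0 := by positivity
  field_simp
  ring

lemma besselCoeff_succ_eq_shift (ν : ℝ) (k : ℕ) :
    (k + 1) * besselCoeff ν (k + 1) = besselCoeff (ν + 1) k / 2 := by
  have h1 : ν + ((k + 1 : ℕ) : ℝ) + 1 = ν + 1 + k + 1 := by push_cast; ring
  have h2 : (2 : ℝ) ^ (-(ν + 1)) = 2 ^ (-ν) / 2 := by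
    rw [neg_add, ← sub_eq_add_neg, Real.rpow_sub_one two_ne_zero]
  have hfac : (k.factorial : ℝ) ≠ 0 := by positivity
  have : (k : ℝ) + 1 ≠ 0 := by positivity
  unfold besselCoeff
  rw [h1, h2, Nat.factorial_succ]
  push_cast
  by_cases hG : Real.Gamma (ν + 1 + k + 1) = 0
  · simp [hG]
  · field_simp
    ring

lemma summable_besselCoeff {ν : ℝ} (hν : -1 < ν) (s : ℝ) :
    Summable fun k : ℕ => besselCoeff ν k * s ^ k := by
  rcases eq_or_ne s 0 with rfl | hs
  · exact summable_of_ne_finset_zero (s := {0}) fun k hk => by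
      simp [show k ≠ 0 by simpa using hk]
  -- The quotient of consecutive terms tends to `0`.
  have hq : ∀ k : ℕ, ‖besselCoeff ν (k + 1) * s ^ (k + 1)‖ / ‖besselCoeff ν k * s ^ k‖
      = |s| / (4 * (k + 1) * (ν + k + 1)) := fun k => by
    have hk : (0 : ℝ) ≤ k := Nat.cast_nonneg k
    have hpos : 0 < ν + k + 1 := by linarith
    have hc := besselCoeff_pos hν (k + 1)
    have hs' : 0 < |s| := abs_pos.2 hs
    rw [← besselCoeff_succ hν k]
    simp only [norm_mul, Real.norm_eq_abs, abs_pow]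
    rw [abs_of_pos hc, abs_of_pos (show (0 : ℝ) < 4 by norm_num), abs_of_pos hpos,
      abs_of_pos (show (0 : ℝ) < k + 1 by positivity), pow_succ]
    field_simp
  have hlim : Filter.Tendsto (fun k : ℕ => |s| / (4 * ((k : ℝ) + 1) * (ν + k + 1)))
      Filter.atTop (nhds 0) := by
    refine Filter.Tendsto.div_atTop tendsto_const_nhds ?_
    refine Filter.Tendsto.atTop_mul_atTop₀ ?_ ?_
    · exact Filter.Tendsto.const_mul_atTop (by norm_num)
        (Filter.tendsto_atTop_add_const_right _ _ tendsto_natCast_atTop_atTop)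
    · exact Filter.tendsto_atTop_add_const_right _ _
        (Filter.tendsto_atTop_add_const_left _ _ tendsto_natCast_atTop_atTop)
  refine summable_of_ratio_test_tendsto_lt_one zero_lt_one (Filter.Eventually.of_forall fun k => ?_)
    (hlim.congr fun k => (hq k).symm)
  exact mul_ne_zero (besselCoeff_pos hν k).ne' (pow_ne_zero _ hs)

lemma besselEntire_pos {ν s : ℝ} (hν : -1 < ν) (hs : 0 ≤ s) : 0 < besselEntire ν s :=
  (summable_besselCoeff hν s).tsum_pos
    (fun k => mul_nonneg (besselCoeff_pos hν k).le (pow_nonneg hs k)) 0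
    (by simpa using besselCoeff_pos hν 0)

lemma besselEntire_zero (ν : ℝ) : besselEntire ν 0 = 2 ^ (-ν) / Real.Gamma (ν + 1) := by
  unfold besselEntire
  rw [tsum_eq_single 0 fun k hk => by simp [hk]]
  simp [besselCoeff]

lemma hasDerivAt_besselEntire {ν : ℝ} (hν : -1 < ν) (s : ℝ) :
    HasDerivAt (besselEntire ν) (besselEntire (ν + 1) s / 2) s := by
  -- Termwise differentiation on a ball containing `s`, the bound being the value at its radius.
  set R : ℝ := |s| + 1 with hR
  have hterm : ∀ (k : ℕ) (y : ℝ),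
      besselCoeff ν (k + 1) * (((k + 1 : ℕ) : ℝ) * y ^ k) = besselCoeff (ν + 1) k / 2 * y ^ k :=
    fun k y => by
      rw [← besselCoeff_succ_eq_shift]; push_cast; ring
  have hsum : Summable fun k : ℕ => besselCoeff ν k * (k * R ^ (k - 1)) := by
    rw [← summable_nat_add_iff 1]
    simp only [Nat.add_sub_cancel, hterm]
    refine ((summable_besselCoeff (ν := ν + 1) (by linarith) R).div_const 2).congr fun k => ?_
    ring
  have hder := hasDerivAt_tsum_of_isPreconnected (g := fun k y => besselCoeff ν k * y ^ k)
    (g' := fun k y => besselCoeff ν k * (k * y ^ (k - 1))) (t := Metric.ball 0 R) (y₀ := 0)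
    (y := s) hsum Metric.isOpen_ball
    (convex_ball (0 : ℝ) R).isPreconnected (fun k y _ => (hasDerivAt_pow k y).const_mul _)
    (fun k y hy => ?_) (Metric.mem_ball_self (by positivity)) (summable_besselCoeff hν 0)
    (by simp [hR])
  · have heq : ∑' k : ℕ, besselCoeff ν k * (k * s ^ (k - 1)) = besselEntire (ν + 1) s / 2 := by
      have hs0 : Summable fun k : ℕ => besselCoeff ν k * (k * s ^ (k - 1)) := by
        rw [← summable_nat_add_iff 1]
        simp only [Nat.add_sub_cancel, hterm]
        refine ((summable_besselCoeff (ν := ν + 1) (by linarith) s).div_const 2).congr fun k => ?_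
        ring
      rw [hs0.tsum_eq_zero_add]
      simp only [Nat.add_sub_cancel, hterm, besselEntire, ← tsum_div_const]
      simp [div_mul_eq_mul_div]
    rw [heq] at hder
    exact hder
  · have hy' : |y| ≤ R := by simpa using (Metric.mem_ball.1 hy).le
    rw [norm_mul, norm_mul, norm_pow, Real.norm_of_nonneg (besselCoeff_pos hν k).le,
      Real.norm_of_nonneg (Nat.cast_nonneg k), Real.norm_eq_abs]
    gcongr
    exact (besselCoeff_pos hν k).le

lemma continuous_besselEntire {ν : ℝ} (hν : -1 < ν) : Continuous (besselEntire ν) :=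
  continuous_iff_continuousAt.2 fun s => (hasDerivAt_besselEntire hν s).continuousAt

lemma contDiff_one_besselEntire {ν : ℝ} (hν : -1 < ν) : ContDiff ℝ 1 (besselEntire ν) := by
  rw [contDiff_one_iff_deriv]
  refine ⟨fun s => (hasDerivAt_besselEntire hν s).differentiableAt, ?_⟩
  rw [show deriv (besselEntire ν) = fun s => besselEntire (ν + 1) s / 2 from
    funext fun s => (hasDerivAt_besselEntire hν s).deriv]
  exact (continuous_besselEntire (by linarith)).div_const 2

/-- The three-term recurrence `I_ν - I_{ν+2} = (2(ν+1)/x) I_{ν+1}`. -/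
lemma besselEntire_recurrence {ν : ℝ} (hν : -1 < ν) (s : ℝ) :
    besselEntire ν s = s * besselEntire (ν + 2) s + 2 * (ν + 1) * besselEntire (ν + 1) s := by
  have h1 : -1 < ν + 1 := by linarith
  have h2 : -1 < ν + 2 := by linarith
  have hS := summable_besselCoeff h1 s
  have hS2 := summable_besselCoeff h2 s
  have hshift : HasSum (fun k : ℕ => (k : ℝ) * besselCoeff (ν + 1) k * s ^ k)
      (s * besselEntire (ν + 2) s / 2) := by
    rw [← hasSum_nat_add_iff' 1]
    have := (hS2.hasSum.mul_left (s / 2))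
    convert! this using 1
    · funext k
      have := besselCoeff_succ_eq_shift (ν + 1) k
      rw [show ν + 1 + 1 = ν + 2 by ring] at this
      push_cast
      rw [this]
      ring
    · simp [besselEntire]
      ring
  have htot := (hshift.mul_left 2).add (hS.hasSum.mul_left (2 * (ν + 1)))
  have hterm : ∀ k : ℕ, 2 * ((k : ℝ) * besselCoeff (ν + 1) k * s ^ k)
      + 2 * (ν + 1) * (besselCoeff (ν + 1) k * s ^ k) = besselCoeff ν k * s ^ k := fun k => by
    linear_combination (4 * (ν + k + 1) * s ^ k) * -besselCoeff_succ_eq_shift ν k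
      + s ^ k * besselCoeff_succ hν k
  simp only [hterm] at htot
  have h := htot.tsum_eq
  unfold besselEntire at h ⊢
  rw [h]
  ring

/-- The inequality `I_{ν+1} < I_ν` for `ν ≥ -1/2`, squared and rescaled: the energy
`F_ν² - s F_{ν+1}²` has derivative `(2ν+1) F_{ν+1}² ≥ 0` and is positive at `s = 0`. -/
lemma mul_besselEntire_sq_lt {ν s : ℝ} (hν : -(1 / 2) ≤ ν) (hs : 0 ≤ s) :
    s * besselEntire (ν + 1) s ^ 2 < besselEntire ν s ^ 2 := by
  have hν' : -1 < ν := by linarith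
  have hder : ∀ y, HasDerivAt
      (fun y => besselEntire ν y ^ 2 - y * besselEntire (ν + 1) y ^ 2)
      ((2 * ν + 1) * besselEntire (ν + 1) y ^ 2) y := fun y => by
    have h0 := hasDerivAt_besselEntire hν' y
    have h1 := hasDerivAt_besselEntire (ν := ν + 1) (by linarith) y
    rw [show ν + 1 + 1 = ν + 2 by ring] at h1
    convert! (h0.pow 2).sub ((hasDerivAt_id y).mul (h1.pow 2)) using 1
    have := besselEntire_recurrence hν' y
    simp only [id, Nat.cast_ofNat, Pi.pow_apply]
    rw [this]
    ring
  have hmono := monotone_of_hasDerivAt_nonneg hder fun y =>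
    mul_nonneg (by linarith) (sq_nonneg _)
  have h := hmono hs
  have hpos := besselEntire_pos hν' le_rfl
  simp only at h
  nlinarith [sq_pos_of_pos hpos]

lemma rpow_mul_besselI {ν x : ℝ} (hx : 0 < x) :
    x ^ (-ν) * besselI ν x = besselEntire ν (x ^ 2) := by
  unfold besselI besselEntire
  rw [← tsum_mul_left]
  refine tsum_congr fun k => ?_
  have h : x ^ (-ν) * (x / 2) ^ (ν + 2 * (k : ℝ)) = 2 ^ (-ν) / 4 ^ k * (x ^ 2) ^ k := by
    have hk : (x / 2) ^ (2 * (k : ℝ)) = (x ^ 2) ^ k / 4 ^ k := by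
      rw [Real.rpow_mul (by positivity), Real.rpow_natCast, ← div_pow]
      congr 1
      rw [Real.rpow_two]
      ring
    rw [Real.rpow_add (by positivity), hk, Real.div_rpow hx.le zero_le_two, Real.rpow_neg hx.le,
      Real.rpow_neg zero_le_two]
    have := Real.rpow_pos_of_pos hx ν
    field_simp
  rw [← mul_div_assoc, h, besselCoeff]
  ring

/-- The Bessel kernel is the restriction to `z ≥ 0` of an expression smooth in all variables. -/
lemma besselKernel_eq {a z ζ t : ℝ} (hz : 0 ≤ z) (hζ : 0 < ζ) (ht : 0 < t) :
    besselKernel a z ζ t = (2 * t) ^ (-(a + 1) / 2)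
      * besselEntire ((a - 1) / 2) ((z * ζ / (2 * t)) ^ 2)
      * Real.exp (-(z ^ 2 + ζ ^ 2) / (4 * t)) := by
  unfold besselKernel
  have he : (1 - a) / 2 = -((a - 1) / 2) := by ring
  split_ifs with h
  · subst h
    have h1 : (a - 1) / 2 + 1 = (a + 1) / 2 := by ring
    simp [besselEntire_zero, he, h1]
  · have hz' : 0 < z := lt_of_le_of_ne hz (Ne.symm h)
    have hx : 0 < z * ζ / (2 * t) := by positivity
    rw [← rpow_mul_besselI hx, he]
    ring

/-! ### Integrals depending on a parameter -/

section Parametric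

variable {P E : Type*} [NormedAddCommGroup P] [NormedSpace ℝ P]
  [NormedAddCommGroup E] [NormedSpace ℝ E]

/-- The derivative of a function of two variables in its first variable. -/
noncomputable def fderivFst (f : P × E → ℝ) (p : P) (q : E) : P →L[ℝ] ℝ :=
  (fderiv ℝ f (p, q)).comp (ContinuousLinearMap.inl ℝ P E)

lemma hasFDerivAt_fderivFst {f : P × E → ℝ} {U : Set P} (hU : IsOpen U)
    (hf : ContDiffOn ℝ 1 f (U ×ˢ univ)) {p : P} (hp : p ∈ U) (q : E) :
    HasFDerivAt (fun p => f (p, q)) (fderivFst f p q) p := by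
  have h : DifferentiableAt ℝ f (p, q) :=
    (hf.differentiableOn one_ne_zero).differentiableAt
      ((hU.prod isOpen_univ).mem_nhds ⟨hp, mem_univ q⟩)
  exact h.hasFDerivAt.comp p (hasFDerivAt_prodMk_left p q)

lemma continuousOn_fderivFst {f : P × E → ℝ} {U : Set P} (hU : IsOpen U)
    (hf : ContDiffOn ℝ 1 f (U ×ˢ univ)) :
    ContinuousOn (fun x : P × E => fderivFst f x.1 x.2) (U ×ˢ univ) :=
  (hf.continuousOn_fderiv_of_isOpen (hU.prod isOpen_univ) le_rfl).clm_comp continuousOn_const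

variable [MeasurableSpace E] [BorelSpace E]
  {μ : Measure E} [IsFiniteMeasureOnCompacts μ]

/-- Differentiation under the integral sign, for a `C¹` integrand with a continuous compactly
supported weight. -/
lemma hasFDerivAt_integral_mul_of_hasCompactSupport [FiniteDimensional ℝ P]
    {f : P × E → ℝ} {U : Set P} (hU : IsOpen U)
    (hf : ContDiffOn ℝ 1 f (U ×ˢ univ)) {w : E → ℝ} (hw : Continuous w)
    (hwc : HasCompactSupport w) {p : P} (hp : p ∈ U) :
    HasFDerivAt (fun p => ∫ q, f (p, q) * w q ∂μ) (∫ q, w q • fderivFst f p q ∂μ) p := by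
  obtain ⟨K, hK, hpK, hKU⟩ := exists_compact_subset hU hp
  have hD := continuousOn_fderivFst hU hf
  obtain ⟨C, hC⟩ := (hK.prod hwc).exists_bound_of_continuousOn
    (hD.mono (prod_mono hKU (subset_univ _)))
  have hcont : ∀ p ∈ U, Continuous fun q => f (p, q) := fun p hp =>
    hf.continuousOn.comp_continuous (by fun_prop) fun q => ⟨hp, mem_univ q⟩
  have hcontD : Continuous fun q => fderivFst f p q :=
    hD.comp_continuous (f := fun q => (p, q)) (by fun_prop) fun q => ⟨hp, mem_univ q⟩
  refine hasFDerivAt_integral_of_dominated_of_fderiv_le (𝕜 := ℝ) (s := K)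
    (F' := fun p q => w q • fderivFst f p q)
    (bound := fun q => C * ‖w q‖) (mem_interior_iff_mem_nhds.1 hpK) ?_ ?_ ?_ ?_ ?_ ?_
  · filter_upwards [hU.mem_nhds hp] with p' hp'
    exact ((hcont p' hp').mul hw).aestronglyMeasurable
  · exact ((hcont p hp).mul hw).integrable_of_hasCompactSupport hwc.mul_left
  · exact (hw.smul hcontD).aestronglyMeasurable
  · refine Filter.Eventually.of_forall fun q p' hp' => ?_
    by_cases hq : w q = 0
    · simp [hq]
    · rw [norm_smul, mul_comm]
      gcongr
      exact hC (p', q) ⟨hp', subset_tsupport _ hq⟩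
  · exact (hw.integrable_of_hasCompactSupport hwc).norm.const_mul C
  · refine Filter.Eventually.of_forall fun q p' hp' => ?_
    simpa [mul_comm] using (hasFDerivAt_fderivFst hU hf (hKU hp') q).mul_const (w q)

/-- Integrated form of a pointwise differential inequality that holds strictly on the support of
the weight. -/
lemma integral_fderivFst_lt {f : P × E → ℝ} {U : Set P} (hU : IsOpen U)
    (hf : ContDiffOn ℝ 1 f (U ×ˢ univ)) {w : E → ℝ} (hw : Continuous w)
    (hwc : HasCompactSupport w) (hw0 : ∀ q, 0 ≤ w q) [μ.IsOpenPosMeasure] (hwne : ∃ q, w q ≠ 0)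
    {p : P} (hp : p ∈ U) (d : P) (c : ℝ)
    (h : ∀ q, w q ≠ 0 → fderivFst f p q d < c * f (p, q)) :
    (∫ q, w q • fderivFst f p q ∂μ) d < c * ∫ q, f (p, q) * w q ∂μ := by
  have hcont : Continuous fun q => f (p, q) :=
    hf.continuousOn.comp_continuous (by fun_prop) fun q => ⟨hp, mem_univ q⟩
  have hcontD : Continuous fun q => fderivFst f p q :=
    (continuousOn_fderivFst hU hf).comp_continuous (f := fun q => (p, q)) (by fun_prop)
      fun q => ⟨hp, mem_univ q⟩
  have hint : Integrable (fun q => w q • fderivFst f p q) μ :=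
    (hw.smul hcontD).integrable_of_hasCompactSupport hwc.smul_right
  have hint' : Integrable (fun q => f (p, q) * w q) μ :=
    (hcont.mul hw).integrable_of_hasCompactSupport hwc.mul_left
  rw [ContinuousLinearMap.integral_apply hint, ← integral_const_mul, ← sub_pos,
    ← integral_sub (hint'.const_mul c) (hint.apply_continuousLinearMap d)]
  obtain ⟨q₀, hq₀⟩ := hwne
  have key : ∀ q, c * (f (p, q) * w q) - (w q • fderivFst f p q) d
      = (c * f (p, q) - fderivFst f p q d) * w q := fun q => by
    simp only [_root_.smul_apply, smul_eq_mul]; ring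
  simp only [key]
  refine Continuous.integral_pos_of_hasCompactSupport_nonneg_nonzero (x := q₀)
    (((hcont.const_mul c).sub (hcontD.clm_apply continuous_const)).mul hw)
    hwc.mul_left (fun q => ?_) (mul_ne_zero (sub_pos.2 (h q₀ hq₀)).ne' hq₀)
  by_cases hq : w q = 0
  · simp [hq]
  · exact mul_nonneg (sub_pos.2 (h q hq)).le (hw0 q)

end Parametric

/-! ### The covariance matrix as a function of time -/

section Gram

-- Any norm making the matrices a normed algebra serves; it induces the entrywise topology.
open scoped Matrix.Norms.Operator

variable {N : ℕ}

/-- The unnormalized covariance matrix `M(t) = t K(t) = ∫₀ᵗ e^{sB} Q e^{sB*} ds`. -/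
noncomputable def gram (Q B : Matrix (Fin N) (Fin N) ℝ) (t : ℝ) : Matrix (Fin N) (Fin N) ℝ :=
  Matrix.of fun i j =>
    ∫ s in (0 : ℝ)..t, (NormedSpace.exp (s • B) * Q * NormedSpace.exp (s • Bᵀ)) i j

lemma hasDerivAt_exp_smul (B : Matrix (Fin N) (Fin N) ℝ) (t : ℝ) :
    HasDerivAt (fun s : ℝ => NormedSpace.exp (s • B)) (NormedSpace.exp (t • B) * B) t :=
  hasDerivAt_exp_smul_const B t

lemma continuous_exp_smul (B : Matrix (Fin N) (Fin N) ℝ) :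
    Continuous fun s : ℝ => NormedSpace.exp (s • B) :=
  continuous_iff_continuousAt.2 fun t => (hasDerivAt_exp_smul B t).continuousAt

lemma contDiff_exp_smul (B : Matrix (Fin N) (Fin N) ℝ) :
    ContDiff ℝ 1 fun s : ℝ => NormedSpace.exp (s • B) := by
  rw [contDiff_one_iff_deriv]
  refine ⟨fun t => (hasDerivAt_exp_smul B t).differentiableAt, ?_⟩
  exact ((continuous_exp_smul B).mul continuous_const).congr
    fun t => (hasDerivAt_exp_smul B t).deriv.symm

lemma continuous_integrand (Q A B : Matrix (Fin N) (Fin N) ℝ) :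
    Continuous fun s : ℝ => NormedSpace.exp (s • A) * Q * NormedSpace.exp (s • B) :=
  ((continuous_exp_smul A).mul continuous_const).mul (continuous_exp_smul B)

/-- The entry `A ↦ A i j` as a continuous linear functional. -/
noncomputable def entryCLM (i j : Fin N) : Matrix (Fin N) (Fin N) ℝ →L[ℝ] ℝ :=
  LinearMap.toContinuousLinearMap (Matrix.entryLinearMap ℝ ℝ i j)

lemma intervalIntegral_apply {f : ℝ → Matrix (Fin N) (Fin N) ℝ} (hf : Continuous f) (a b : ℝ)
    (i j : Fin N) : (∫ s in a..b, f s) i j = ∫ s in a..b, f s i j :=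
  ((entryCLM i j).intervalIntegral_comp_comm (hf.intervalIntegrable a b)).symm

lemma gram_eq_integral (Q B : Matrix (Fin N) (Fin N) ℝ) (t : ℝ) :
    gram Q B t = ∫ s in (0 : ℝ)..t, NormedSpace.exp (s • B) * Q * NormedSpace.exp (s • Bᵀ) := by
  ext i j
  rw [intervalIntegral_apply (continuous_integrand Q B Bᵀ)]
  rfl

lemma covC_eq_integral (Q B : Matrix (Fin N) (Fin N) ℝ) (t : ℝ) :
    covC Q B t
      = ∫ s in (0 : ℝ)..t, NormedSpace.exp (-s • B) * Q * NormedSpace.exp (-s • Bᵀ) := by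
  ext i j
  exact (intervalIntegral_apply ((continuous_integrand Q B Bᵀ).comp continuous_neg) 0 t i j).symm

lemma hasDerivAt_gram (Q B : Matrix (Fin N) (Fin N) ℝ) (t : ℝ) :
    HasDerivAt (gram Q B) (NormedSpace.exp (t • B) * Q * NormedSpace.exp (t • Bᵀ)) t := by
  have hc := continuous_integrand Q B Bᵀ
  rw [show gram Q B = fun t => ∫ s in (0 : ℝ)..t, NormedSpace.exp (s • B) * Q *
    NormedSpace.exp (s • Bᵀ) from funext (gram_eq_integral Q B)]
  exact (hc.integral_hasStrictDerivAt 0 t).hasDerivAt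

lemma contDiff_gram (Q B : Matrix (Fin N) (Fin N) ℝ) : ContDiff ℝ 1 (gram Q B) := by
  rw [contDiff_one_iff_deriv]
  refine ⟨fun t => (hasDerivAt_gram Q B t).differentiableAt, ?_⟩
  exact (continuous_integrand Q B Bᵀ).congr fun t => (hasDerivAt_gram Q B t).deriv.symm

lemma exp_smul_mul_exp_smul (B : Matrix (Fin N) (Fin N) ℝ) (s t : ℝ) :
    NormedSpace.exp (s • B) * NormedSpace.exp (t • B) = NormedSpace.exp ((s + t) • B) := by
  rw [add_smul, Matrix.exp_add_of_commute]
  exact ((Commute.refl B).smul_left s).smul_right t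

/-- `M(t) = e^{tB} C(t) e^{tB*}`. -/
lemma gram_eq_conj_covC (Q B : Matrix (Fin N) (Fin N) ℝ) (t : ℝ) :
    gram Q B t = NormedSpace.exp (t • B) * covC Q B t * NormedSpace.exp (t • Bᵀ) := by
  have hc := (continuous_integrand Q B Bᵀ).comp continuous_neg
  have h := intervalIntegral.integral_comp_sub_left (a := 0) (b := t)
    (fun s : ℝ => NormedSpace.exp (s • B) * Q * NormedSpace.exp (s • Bᵀ)) t
  rw [sub_self, sub_zero] at h
  rw [gram_eq_integral, ← h, covC_eq_integral]
  have := ((ContinuousLinearMap.mulLeftRight ℝ (Matrix (Fin N) (Fin N) ℝ)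
    (NormedSpace.exp (t • B)) (NormedSpace.exp (t • Bᵀ))).intervalIntegral_comp_comm
      (hc.intervalIntegrable (μ := volume) 0 t))
  refine Eq.trans (intervalIntegral.integral_congr fun s _ => ?_) this
  simp only [ContinuousLinearMap.mulLeftRight_apply, Function.comp_apply]
  rw [sub_eq_add_neg, ← exp_smul_mul_exp_smul B, add_comm t (-s), ← exp_smul_mul_exp_smul Bᵀ]
  noncomm_ring

lemma trace_inv_gram_mul (Q B : Matrix (Fin N) (Fin N) ℝ) (t : ℝ) :
    ((gram Q B t)⁻¹ * (NormedSpace.exp (t • B) * Q * NormedSpace.exp (t • Bᵀ))).trace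
      = (Q * (covC Q B t)⁻¹).trace := by
  have h1 := (Matrix.isUnit_iff_isUnit_det _).1 (Matrix.isUnit_exp (t • B))
  have h2 := (Matrix.isUnit_iff_isUnit_det _).1 (Matrix.isUnit_exp (t • Bᵀ))
  rw [gram_eq_conj_covC, Matrix.mul_inv_rev, Matrix.mul_inv_rev]
  set E := NormedSpace.exp (t • B)
  set E' := NormedSpace.exp (t • Bᵀ)
  rw [show E'⁻¹ * ((covC Q B t)⁻¹ * E⁻¹) * (E * Q * E')
    = E'⁻¹ * ((covC Q B t)⁻¹ * (E⁻¹ * E) * Q * E') by noncomm_ring, Matrix.nonsing_inv_mul _ h1,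
    Matrix.trace_mul_comm, mul_one, Matrix.mul_assoc, Matrix.mul_nonsing_inv _ h2, mul_one,
    Matrix.trace_mul_comm]

lemma contDiff_det : ContDiff ℝ 1 (Matrix.det : Matrix (Fin N) (Fin N) ℝ → ℝ) := by
  have : (Matrix.det : Matrix (Fin N) (Fin N) ℝ → ℝ)
      = fun A => ∑ σ : Equiv.Perm (Fin N), (Equiv.Perm.sign σ : ℝ) * ∏ i, entryCLM (σ i) i A := by
    funext A
    rw [Matrix.det_apply']
    rfl
  rw [this]
  exact ContDiff.sum fun σ _ => contDiff_const.mul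
    (contDiff_prod fun i _ => (entryCLM (σ i) i).contDiff)

/-- Jacobi's formula for the derivative of the determinant, at an invertible matrix. -/
lemma fderiv_det_apply {A : Matrix (Fin N) (Fin N) ℝ} (hA : A.det ≠ 0)
    (H : Matrix (Fin N) (Fin N) ℝ) :
    fderiv ℝ Matrix.det A H = A.det * (A⁻¹ * H).trace := by
  have hline : HasDerivAt (fun r : ℝ => A + r • H) H 0 := by
    have h := ((hasDerivAt_id (0 : ℝ)).smul_const H).const_add A
    rwa [one_smul] at h
  have h1 : HasDerivAt (fun r : ℝ => (A + r • H).det) (fderiv ℝ Matrix.det A H) 0 := by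
    have hd : HasFDerivAt Matrix.det (fderiv ℝ Matrix.det A) (A + (0 : ℝ) • H) := by
      rw [zero_smul, add_zero]
      exact (contDiff_det.differentiable one_ne_zero A).hasFDerivAt
    exact hd.comp_hasDerivAt 0 hline
  -- Along the line `A + r H` the determinant is `det A` times `1 + tr(A⁻¹ H) r + O(r²)`.
  obtain ⟨p, hp⟩ : ∃ p : Polynomial ℝ, ∀ r : ℝ,
      (1 + r • (A⁻¹ * H)).det = 1 + (A⁻¹ * H).trace * r + p.eval r * r ^ 2 :=
    ⟨_, fun r => Matrix.det_one_add_smul r (A⁻¹ * H)⟩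
  have h2 : HasDerivAt (fun r : ℝ => (A + r • H).det) (A.det * (A⁻¹ * H).trace) 0 := by
    have heq : (fun r : ℝ => (A + r • H).det)
        = fun r => A.det * (1 + (A⁻¹ * H).trace * r + p.eval r * r ^ 2) := by
      funext r
      rw [← hp, ← Matrix.det_mul, mul_add, mul_one, Matrix.mul_smul, ← Matrix.mul_assoc,
        Matrix.mul_nonsing_inv _ hA.isUnit, one_mul]
    rw [heq]
    convert! ((((hasDerivAt_id (0 : ℝ)).const_mul (A⁻¹ * H).trace).const_add 1).add
      ((p.hasDerivAt 0).mul ((hasDerivAt_id (0 : ℝ)).pow 2))).const_mul A.det using 1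
    simp
  exact h1.unique h2

lemma _root_.HasDerivAt.log_det {M : ℝ → Matrix (Fin N) (Fin N) ℝ} {M' : Matrix (Fin N) (Fin N) ℝ}
    {s : ℝ} (hM : HasDerivAt M M' s) (h : (M s).det ≠ 0) :
    HasDerivAt (fun s => Real.log (M s).det) ((M s)⁻¹ * M').trace s := by
  have hd := ((contDiff_det.differentiable one_ne_zero
    (M s)).hasFDerivAt.comp_hasDerivAt s hM).log h
  have he := fderiv_det_apply h M'
  convert! hd using 1
  exact ((congrArg (· / (M s).det) he).trans (mul_div_cancel_left₀ _ h)).symm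

lemma _root_.HasDerivAt.matrix_inv {M : ℝ → Matrix (Fin N) (Fin N) ℝ}
    {M' : Matrix (Fin N) (Fin N) ℝ} {s : ℝ} (hM : HasDerivAt M M' s) (h : (M s).det ≠ 0) :
    HasDerivAt (fun s => (M s)⁻¹) (-((M s)⁻¹ * M' * (M s)⁻¹)) s := by
  obtain ⟨U, hU⟩ := (Matrix.isUnit_iff_isUnit_det (M s)).2 h.isUnit
  have hi := hasFDerivAt_ringInverse (𝕜 := ℝ) U
  rw [hU] at hi
  have := hi.comp_hasDerivAt s hM
  have hUi : (↑U⁻¹ : Matrix (Fin N) (Fin N) ℝ) = (M s)⁻¹ := by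
    rw [← hU, Matrix.coe_units_inv]
  simp only [hUi, _root_.neg_apply, ContinuousLinearMap.mulLeftRight_apply] at this
  exact this.congr_of_eventuallyEq
    (Filter.Eventually.of_forall fun s => Matrix.nonsing_inv_eq_ringInverse _)

lemma _root_.ContDiffOn.matrix_inv {M : ℝ → Matrix (Fin N) (Fin N) ℝ} {S : Set ℝ}
    (hM : ContDiffOn ℝ 1 M S) (h : ∀ s ∈ S, (M s).det ≠ 0) :
    ContDiffOn ℝ 1 (fun s => (M s)⁻¹) S := by
  intro s hs
  obtain ⟨U, hU⟩ := (Matrix.isUnit_iff_isUnit_det (M s)).2 (h s hs).isUnit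
  have hi := contDiffAt_ringInverse (n := 1) ℝ U
  rw [hU] at hi
  simp only [Matrix.nonsing_inv_eq_ringInverse]
  exact hi.comp_contDiffWithinAt s (hM s hs)

/-- The action of matrices on Euclidean space, as a continuous linear map. -/
noncomputable def actCLM (N : ℕ) : Matrix (Fin N) (Fin N) ℝ →L[ℝ]
    (EuclideanSpace ℝ (Fin N) →L[ℝ] EuclideanSpace ℝ (Fin N)) :=
  LinearMap.toContinuousLinearMap
    (Matrix.toEuclideanCLM (n := Fin N) (𝕜 := ℝ)).toAlgEquiv.toLinearMap

lemma actCLM_apply (A : Matrix (Fin N) (Fin N) ℝ) (x : EuclideanSpace ℝ (Fin N)) :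
    actCLM N A x = Matrix.toEuclideanLin A x := rfl

lemma actCLM_mul (A A' : Matrix (Fin N) (Fin N) ℝ) (x : EuclideanSpace ℝ (Fin N)) :
    actCLM N (A * A') x = actCLM N A (actCLM N A' x) :=
  congrArg (fun L => L x) (map_mul (Matrix.toEuclideanCLM (n := Fin N) (𝕜 := ℝ)) A A')

lemma inner_actCLM (A : Matrix (Fin N) (Fin N) ℝ) (x y : EuclideanSpace ℝ (Fin N)) :
    inner ℝ (actCLM N A x) y = inner ℝ x (actCLM N Aᵀ y) := by
  rw [real_inner_comm]
  simp only [actCLM_apply, Matrix.toLpLin_apply, EuclideanSpace.inner_eq_star_dotProduct]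
  simp [Matrix.dotProduct_mulVec, Matrix.vecMul_transpose, dotProduct_comm]

lemma inner_actCLM_self_nonneg {A : Matrix (Fin N) (Fin N) ℝ} (hA : A.PosSemidef)
    (x : EuclideanSpace ℝ (Fin N)) : 0 ≤ inner ℝ (actCLM N A x) x := by
  have := hA.dotProduct_mulVec_nonneg x.ofLp
  rw [real_inner_comm]
  simpa [actCLM_apply, Matrix.toLpLin_apply, EuclideanSpace.inner_eq_star_dotProduct,
    dotProduct_comm] using this

lemma hasDerivAt_actCLM {M : ℝ → Matrix (Fin N) (Fin N) ℝ} {M' : Matrix (Fin N) (Fin N) ℝ}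
    {y : ℝ → EuclideanSpace ℝ (Fin N)} {y' : EuclideanSpace ℝ (Fin N)}
    {s : ℝ} (hM : HasDerivAt M M' s) (hy : HasDerivAt y y' s) :
    HasDerivAt (fun s => actCLM N (M s) (y s)) (actCLM N M' (y s) + actCLM N (M s) y') s :=
  ((actCLM N).hasFDerivAt.comp_hasDerivAt s hM).clm_apply hy

/-- Derivative of a quadratic form `⟨M⁻¹ D, D⟩` along a curve of symmetric matrices. -/
lemma hasDerivAt_inner_inv {M : ℝ → Matrix (Fin N) (Fin N) ℝ} {M' : Matrix (Fin N) (Fin N) ℝ}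
    {D : ℝ → EuclideanSpace ℝ (Fin N)} {D' : EuclideanSpace ℝ (Fin N)} {s : ℝ}
    (hM : HasDerivAt M M' s) (h : (M s).det ≠ 0) (hsymm : (M s)ᵀ = M s)
    (hD : HasDerivAt D D' s) :
    HasDerivAt (fun s => inner ℝ (actCLM N (M s)⁻¹ (D s)) (D s))
      (2 * inner ℝ (actCLM N (M s)⁻¹ (D s)) D'
        - inner ℝ (actCLM N M' (actCLM N (M s)⁻¹ (D s))) (actCLM N (M s)⁻¹ (D s))) s := by
  have hs' : ((M s)⁻¹)ᵀ = (M s)⁻¹ := by rw [Matrix.transpose_nonsing_inv, hsymm]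
  convert! (hasDerivAt_actCLM (hM.matrix_inv h) hD).inner ℝ hD using 1
  rw [map_neg, _root_.neg_apply, actCLM_mul, actCLM_mul, inner_add_left, inner_neg_left,
    inner_actCLM _ _ (D s), inner_actCLM _ D' (D s), hs', real_inner_comm _ D']
  ring

end Gram

/-! ### Logarithms of the two kernels -/

section Kernels

open scoped Matrix.Norms.Operator

variable {N : ℕ}

/-- The logarithm of the Gaussian kernel `p(X,Y,t)` up to an additive constant, with
`M(t) = t K(t)`: `-½ log det M(t) - ¼ ⟨M(t)⁻¹ (Y - e^{tB} X), Y - e^{tB} X⟩`. -/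
noncomputable def logGauss (Q B : Matrix (Fin N) (Fin N) ℝ) (X : EuclideanSpace ℝ (Fin N)) (t : ℝ)
    (Y : EuclideanSpace ℝ (Fin N)) : ℝ :=
  -(1 / 2) * Real.log (gram Q B t).det
    - 1 / 4 * inner ℝ (actCLM N (gram Q B t)⁻¹ (Y - actCLM N (NormedSpace.exp (t • B)) X))
        (Y - actCLM N (NormedSpace.exp (t • B)) X)

/-- The logarithm of the Bessel kernel `p^{(a)}(z,ζ,t)`, extended evenly to negative `z` and `ζ`. -/
noncomputable def logBessel (a z t ζ : ℝ) : ℝ :=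
  -(a + 1) / 2 * Real.log (2 * t)
    + Real.log (besselEntire ((a - 1) / 2) ((z * ζ / (2 * t)) ^ 2)) - (z ^ 2 + ζ ^ 2) / (4 * t)

lemma gram_eq_smul_covK (Q B : Matrix (Fin N) (Fin N) ℝ) {t : ℝ} (ht : 0 < t) :
    gram Q B t = t • covK Q B t := by
  rw [covK, smul_smul, mul_one_div_cancel ht.ne', one_smul]
  rfl

lemma posDef_gram {Q B : Matrix (Fin N) (Fin N) ℝ} {t : ℝ} (ht : 0 < t)
    (hK : (covK Q B t).PosDef) : (gram Q B t).PosDef := by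
  rw [gram_eq_smul_covK Q B ht]
  exact hK.smul ht

lemma transpose_gram {Q B : Matrix (Fin N) (Fin N) ℝ} {t : ℝ} (ht : 0 < t)
    (hK : (covK Q B t).PosDef) : (gram Q B t)ᵀ = gram Q B t := by
  have := (posDef_gram ht hK).isHermitian.eq
  rwa [Matrix.conjTranspose_eq_transpose_of_trivial] at this

/-- The constant `c_N / ω_N` in front of the Gaussian kernel, where `ω_N` is the volume of the unit
ball. -/
noncomputable def gaussConst (N : ℕ) : ℝ :=
  ((4 : ℝ) ^ ((N : ℝ) / 2) * Real.Gamma ((N : ℝ) / 2 + 1))⁻¹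
    / (volume (Metric.ball (0 : EuclideanSpace ℝ (Fin N)) 1)).toReal

lemma gaussConst_pos (N : ℕ) : 0 < gaussConst N := by
  have h1 : 0 < Real.Gamma ((N : ℝ) / 2 + 1) := Real.Gamma_pos_of_pos (by positivity)
  have h2 : 0 < (volume (Metric.ball (0 : EuclideanSpace ℝ (Fin N)) 1)).toReal :=
    ENNReal.toReal_pos (Metric.measure_ball_pos _ _ one_pos).ne' measure_ball_lt_top.ne
  unfold gaussConst
  positivity

lemma kernelP_eq {Q B : Matrix (Fin N) (Fin N) ℝ} {t : ℝ} (ht : 0 < t)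
    (hK : (covK Q B t).PosDef) (X Y : EuclideanSpace ℝ (Fin N)) :
    kernelP Q B X Y t = gaussConst N * Real.exp (logGauss Q B X t Y) := by
  have hdet : 0 < (gram Q B t).det := (posDef_gram ht hK).det_pos
  have hinv : (covK Q B t)⁻¹ = t • (gram Q B t)⁻¹ := by
    refine Matrix.inv_eq_left_inv ?_
    rw [Matrix.smul_mul, ← Matrix.mul_smul, ← gram_eq_smul_covK Q B ht,
      Matrix.nonsing_inv_mul _ hdet.ne'.isUnit]
  have hsq : pseudoDist Q B t X Y ^ 2
      = t * inner ℝ (actCLM N (gram Q B t)⁻¹ (Y - actCLM N (NormedSpace.exp (t • B)) X))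
        (Y - actCLM N (NormedSpace.exp (t • B)) X) := by
    unfold pseudoDist
    rw [← actCLM_apply, Real.sq_sqrt]
    · rw [← actCLM_apply, hinv, map_smul, _root_.smul_apply, real_inner_smul_left]
    · rw [← actCLM_apply]
      exact inner_actCLM_self_nonneg hK.inv.posSemidef _
  have hlog : Real.exp (-(1 / 2) * Real.log (gram Q B t).det) = (√(gram Q B t).det)⁻¹ := by
    rw [Real.sqrt_eq_rpow, ← Real.rpow_neg hdet.le, Real.rpow_def_of_pos hdet, mul_comm]
  rw [logGauss, sub_eq_add_neg, Real.exp_add, hlog, kernelP, hsq, volFun, gaussConst,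
    ← gram_eq_smul_covK Q B ht, ← div_div, div_eq_mul_inv _ √_, mul_assoc]
  congr 3
  field_simp

lemma besselKernel_eq_exp {a z ζ t : ℝ} (ha : -1 < a) (hz : 0 ≤ z) (hζ : 0 < ζ) (ht : 0 < t) :
    besselKernel a z ζ t = Real.exp (logBessel a z t ζ) := by
  have hF := besselEntire_pos (ν := (a - 1) / 2) (by linarith) (sq_nonneg (z * ζ / (2 * t)))
  rw [besselKernel_eq hz hζ ht, logBessel, sub_eq_add_neg (_ + _), Real.exp_add, Real.exp_add,
    Real.exp_log hF, Real.rpow_def_of_pos (by positivity), neg_div, mul_comm (Real.log _), neg_div]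

/-- Derivative of the logarithm of the Gaussian kernel in the direction `(2 Q v + B X, -1)`. With
`w = ∇_X log p` it equals `½ tr (Q C(t)⁻¹) + 2 ⟨Q w, v⟩ - ⟨Q w, w⟩`. -/
lemma exists_hasDerivAt_logGauss {Q B : Matrix (Fin N) (Fin N) ℝ} (hQ : Q.PosSemidef) {t : ℝ}
    (ht : 0 < t) (hK : (covK Q B t).PosDef) (X Y v : EuclideanSpace ℝ (Fin N)) :
    ∃ m, HasDerivAt (fun s : ℝ => logGauss Q B
        (X + s • ((2 : ℝ) • actCLM N Q v + actCLM N B X)) (t + s * -1) Y) m 0 ∧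
      m ≤ 1 / 2 * (Q * (covC Q B t)⁻¹).trace + inner ℝ (actCLM N Q v) v := by
  set h := (2 : ℝ) • actCLM N Q v + actCLM N B X with hh
  have hτ : HasDerivAt (fun s : ℝ => t + s * -1) (-1) 0 := by
    simpa using ((hasDerivAt_id (0 : ℝ)).mul_const (-1)).const_add t
  have hτ0 : t + 0 * -1 = t := by ring
  have hdet : (gram Q B (t + 0 * -1)).det ≠ 0 := by
    rw [hτ0]; exact (posDef_gram ht hK).det_pos.ne'
  have hsymm : (gram Q B (t + 0 * -1))ᵀ = gram Q B (t + 0 * -1) := by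
    rw [hτ0]; exact transpose_gram ht hK
  have hM := (hasDerivAt_gram Q B (t + 0 * -1)).scomp (0 : ℝ) hτ
  have hE := (hasDerivAt_exp_smul B (t + 0 * -1)).scomp (0 : ℝ) hτ
  have hX : HasDerivAt (fun s : ℝ => X + s • h) h 0 := by
    have h := ((hasDerivAt_id (0 : ℝ)).smul_const h).const_add X
    rwa [one_smul] at h
  have hD := (hasDerivAt_const (0 : ℝ) Y).sub (hasDerivAt_actCLM hE hX)
  have hfin := ((hM.log_det hdet).const_mul (-(1 / 2))).sub
    ((hasDerivAt_inner_inv hM hdet hsymm hD).const_mul (1 / 4))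
  refine ⟨_, hfin, ?_⟩
  simp only [Function.comp_apply, zero_smul, add_zero, Pi.sub_apply, zero_sub]
  rw [hτ0]
  set E := NormedSpace.exp (t • B) with hEdef
  have hET : NormedSpace.exp (t • Bᵀ) = Eᵀ := by
    rw [hEdef, ← Matrix.exp_transpose, Matrix.transpose_smul]
  set η := actCLM N (gram Q B t)⁻¹ (Y - actCLM N E X) with hη
  have htr := trace_inv_gram_mul Q B t
  rw [neg_one_smul, neg_one_smul, mul_neg, Matrix.trace_neg, htr, map_neg, map_neg,
    _root_.neg_apply, _root_.neg_apply, actCLM_mul E B X, hET, actCLM_mul, actCLM_mul]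
  -- `w / 2` is the spatial gradient of `logGauss`; the square to complete is that of `w / 2 - v`.
  set w := actCLM N Eᵀ η with hw
  have e1 : inner ℝ η (-(-actCLM N E (actCLM N B X) + actCLM N E h))
      = -2 * inner ℝ w (actCLM N Q v) := by
    rw [hh, map_add, map_smul, neg_add, neg_neg, neg_add, add_comm, add_assoc, neg_add_cancel,
      add_zero, inner_neg_right, real_inner_smul_right, hw, inner_actCLM Eᵀ η,
      Matrix.transpose_transpose]
    ring
  have e2 : inner ℝ (actCLM N E (actCLM N Q w)) η = inner ℝ (actCLM N Q w) w := by
    rw [inner_actCLM]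
  have e3 := inner_actCLM_self_nonneg hQ ((1 / 2 : ℝ) • w - v)
  have hQs : Qᵀ = Q := by
    have := hQ.isHermitian.eq
    rwa [Matrix.conjTranspose_eq_transpose_of_trivial] at this
  have e4 : inner ℝ (actCLM N Q w) v = inner ℝ w (actCLM N Q v) := by rw [inner_actCLM, hQs]
  have e5 : inner ℝ (actCLM N Q v) w = inner ℝ w (actCLM N Q v) := real_inner_comm _ _
  rw [map_sub, map_smul, inner_sub_left, inner_sub_right, inner_sub_right, real_inner_smul_left,
    real_inner_smul_left, real_inner_smul_right, real_inner_smul_right, e4, e5] at e3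
  rw [e1, inner_neg_left, e2]
  linarith

/-- Derivative of the logarithm of the Bessel kernel in the direction `(2 b, -1)` of the
`(z, t)`-plane. With `r = x F_{ν+1}(x²) / F_ν(x²)`, `x = z ζ / (2 t)`, and
`β = ∂_z log p^{(a)} = (r ζ - z) / (2 t)`, it equals
`(a + 1) / (2 t) + ζ² (r² - 1) / (4 t²) + 2 b β - β²`. -/
lemma exists_hasDerivAt_logBessel {a z t ζ : ℝ} (ha : -1 < a) (haz : 0 ≤ a ∨ z = 0) (ht : 0 < t)
    (hζ : ζ ≠ 0) (b : ℝ) :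
    ∃ m, HasDerivAt (fun s : ℝ => logBessel a (z + s * (2 * b)) (t + s * -1) ζ) m 0 ∧
      m < (a + 1) / (2 * t) + b ^ 2 := by
  set ν := (a - 1) / 2 with hν
  have hν' : -1 < ν := by rw [hν]; linarith
  have hτ : HasDerivAt (fun s : ℝ => t + s * -1) (-1) 0 := by
    simpa using ((hasDerivAt_id (0 : ℝ)).mul_const (-1)).const_add t
  have hZ : HasDerivAt (fun s : ℝ => z + s * (2 * b)) (2 * b) 0 := by
    simpa using ((hasDerivAt_id (0 : ℝ)).mul_const (2 * b)).const_add z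
  have hτ0 : t + 0 * -1 = t := by ring
  have hZ0 : z + 0 * (2 * b) = z := by ring
  have hx := (((hZ.mul_const ζ).fun_div (hτ.const_mul 2)
    (by rw [hτ0]; positivity)).fun_pow 2)
  have hF0 := besselEntire_pos hν' (sq_nonneg (z * ζ / (2 * t)))
  have hF := ((hasDerivAt_besselEntire hν' _).comp (0 : ℝ) hx).log
    (by simp only [Function.comp_apply, hτ0, hZ0]; exact hF0.ne')
  have hfin := ((((hτ.const_mul 2).log (by rw [hτ0]; positivity)).const_mul (-(a + 1) / 2)).add
    hF).sub (((hZ.fun_pow 2).add_const (ζ ^ 2)).fun_div (hτ.const_mul 4)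
      (by rw [hτ0]; positivity))
  refine ⟨_, hfin, ?_⟩
  simp only [Function.comp_apply, hτ0, hZ0]
  set x := z * ζ / (2 * t) with hxdef
  clear_value x
  set r := x * (besselEntire (ν + 1) (x ^ 2) / besselEntire ν (x ^ 2)) with hr
  have hr1 : r ^ 2 < 1 := by
    have : x ^ 2 * besselEntire (ν + 1) (x ^ 2) ^ 2 < besselEntire ν (x ^ 2) ^ 2 := by
      rcases haz with h | h
      · exact mul_besselEntire_sq_lt (by rw [hν]; linarith) (sq_nonneg x)
      · have hx0 : x = 0 := by rw [hxdef, h]; simp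
        rw [hx0] at hF0 ⊢
        simpa using pow_pos hF0 2
    rw [hr, mul_pow, div_pow, ← mul_div_assoc, div_lt_one (by positivity)]
    exact this
  have hneg : ζ ^ 2 / (4 * t ^ 2) * (r ^ 2 - 1) < 0 :=
    mul_neg_of_pos_of_neg (by positivity) (by linarith)
  have hsq := sq_nonneg (b - (r * ζ - z) / (2 * t))
  refine lt_of_eq_of_lt (b := (a + 1) / (2 * t) + ζ ^ 2 / (4 * t ^ 2) * (r ^ 2 - 1)
    + (b ^ 2 - (b - (r * ζ - z) / (2 * t)) ^ 2)) ?_ (by linarith)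
  have hGr : besselEntire (ν + 1) (x ^ 2) / 2 * (((2 : ℕ) : ℝ) * x ^ (2 - 1) *
      ((2 * b * ζ * (2 * t) - z * ζ * (2 * -1)) / (2 * t) ^ 2)) / besselEntire ν (x ^ 2)
      = r * (b * ζ / t + z * ζ / (2 * t ^ 2)) := by
    rw [hr]
    simp only [Nat.cast_ofNat, Nat.add_one_sub_one, pow_one]
    field_simp
    ring
  rw [hGr]
  simp only [Nat.cast_ofNat, Nat.add_one_sub_one, pow_one]
  field_simp
  ring

/-- The kernel of the extension semigroup without its constant factor, as a function of
`((X, t, z), (Y, ζ))`, extended evenly to negative `z` and `ζ`. -/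
noncomputable def extKernel (Q B : Matrix (Fin N) (Fin N) ℝ) (a : ℝ)
    (x : (EuclideanSpace ℝ (Fin N) × ℝ × ℝ) × (EuclideanSpace ℝ (Fin N) × ℝ)) : ℝ :=
  Real.exp (logGauss Q B x.1.1 x.1.2.1 x.2.1 + logBessel a x.1.2.2 x.1.2.1 x.2.2)

lemma contDiffOn_extKernel {Q B : Matrix (Fin N) (Fin N) ℝ}
    (hK : ∀ t : ℝ, 0 < t → (covK Q B t).PosDef) {a : ℝ} (ha : -1 < a) :
    ContDiffOn ℝ 1 (extKernel Q B a) ({p | 0 < p.2.1} ×ˢ univ) := by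
  set S : Set ((EuclideanSpace ℝ (Fin N) × ℝ × ℝ) × (EuclideanSpace ℝ (Fin N) × ℝ)) :=
    {p | 0 < p.2.1} ×ˢ univ
  have htime : ContDiffOn ℝ 1 (fun x : (EuclideanSpace ℝ (Fin N) × ℝ × ℝ) ×
      (EuclideanSpace ℝ (Fin N) × ℝ) => x.1.2.1) S := by fun_prop
  have hmaps : MapsTo (fun x : (EuclideanSpace ℝ (Fin N) × ℝ × ℝ) ×
      (EuclideanSpace ℝ (Fin N) × ℝ) => x.1.2.1) S (Ioi 0) := fun x hx => hx.1
  have hdet : ∀ t ∈ Ioi (0 : ℝ), (gram Q B t).det ≠ 0 := fun t ht =>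
    (posDef_gram ht (hK t ht)).det_pos.ne'
  have h1 : ContDiffOn ℝ 1 (fun t => Real.log (gram Q B t).det) (Ioi 0) :=
    (contDiff_det.comp (contDiff_gram Q B)).contDiffOn.log hdet
  have h2 : ContDiffOn ℝ 1 (fun t => actCLM N (gram Q B t)⁻¹) (Ioi 0) :=
    (actCLM N).contDiff.comp_contDiffOn ((contDiff_gram Q B).contDiffOn.matrix_inv hdet)
  have h3 : ContDiff ℝ 1 (fun t : ℝ => actCLM N (NormedSpace.exp (t • B))) :=
    (actCLM N).contDiff.comp (contDiff_exp_smul B)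
  have hD : ContDiffOn ℝ 1 (fun x : (EuclideanSpace ℝ (Fin N) × ℝ × ℝ) ×
      (EuclideanSpace ℝ (Fin N) × ℝ) => x.2.1 - actCLM N (NormedSpace.exp (x.1.2.1 • B)) x.1.1) S :=
    ContDiffOn.sub (by fun_prop) ((h3.comp_contDiffOn htime).clm_apply (by fun_prop))
  have hG : ContDiffOn ℝ 1 (fun x : (EuclideanSpace ℝ (Fin N) × ℝ × ℝ) ×
      (EuclideanSpace ℝ (Fin N) × ℝ) => logGauss Q B x.1.1 x.1.2.1 x.2.1) S :=
    (contDiffOn_const.mul (h1.comp htime hmaps)).sub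
      (contDiffOn_const.mul (((h2.comp htime hmaps).clm_apply hD).inner ℝ hD))
  have hν : -1 < (a - 1) / 2 := by linarith
  have hpos : ∀ x ∈ S, (0 : ℝ) < x.1.2.1 := hmaps
  have hx : ContDiffOn ℝ 1 (fun x : (EuclideanSpace ℝ (Fin N) × ℝ × ℝ) ×
      (EuclideanSpace ℝ (Fin N) × ℝ) => (x.1.2.2 * x.2.2 / (2 * x.1.2.1)) ^ 2) S :=
    (ContDiffOn.div (by fun_prop) (contDiffOn_const.mul htime)
      fun x hx => by have := hpos x hx; positivity).pow 2
  have hB : ContDiffOn ℝ 1 (fun x : (EuclideanSpace ℝ (Fin N) × ℝ × ℝ) ×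
      (EuclideanSpace ℝ (Fin N) × ℝ) => logBessel a x.1.2.2 x.1.2.1 x.2.2) S := by
    refine ContDiffOn.sub (ContDiffOn.add (contDiffOn_const.mul
      ((contDiffOn_const.mul htime).log fun x hx => ?_))
      (((contDiff_one_besselEntire hν).comp_contDiffOn hx).log fun x _ => ?_))
      (ContDiffOn.div (by fun_prop) (contDiffOn_const.mul htime) fun x hx => ?_)
    · have := hpos x hx; positivity
    · exact (besselEntire_pos hν (sq_nonneg _)).ne'
    · have := hpos x hx; positivity
  exact (hG.add hB).exp

/-- The pointwise differential inequality for the kernel, linearized at the vector `v` and the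
number `b` by completing the squares. -/
lemma fderivFst_extKernel_lt {Q B : Matrix (Fin N) (Fin N) ℝ} (hQ : Q.PosSemidef)
    (hK : ∀ t : ℝ, 0 < t → (covK Q B t).PosDef) {a z t ζ : ℝ} (ha : -1 < a)
    (haz : 0 ≤ a ∨ z = 0) (ht : 0 < t) (hζ : ζ ≠ 0) (X Y v : EuclideanSpace ℝ (Fin N)) (b : ℝ) :
    fderivFst (extKernel Q B a) (X, t, z) (Y, ζ)
        ((2 : ℝ) • actCLM N Q v + actCLM N B X, -1, 2 * b)
      < (1 / 2 * (Q * (covC Q B t)⁻¹).trace + (a + 1) / (2 * t)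
          + inner ℝ (actCLM N Q v) v + b ^ 2) * extKernel Q B a ((X, t, z), (Y, ζ)) := by
  set d : EuclideanSpace ℝ (Fin N) × ℝ × ℝ :=
    ((2 : ℝ) • actCLM N Q v + actCLM N B X, -1, 2 * b) with hd
  obtain ⟨m₁, h₁, hm₁⟩ := exists_hasDerivAt_logGauss hQ ht (hK t ht) X Y v
  obtain ⟨m₂, h₂, hm₂⟩ := exists_hasDerivAt_logBessel ha haz ht hζ b
  have hU : IsOpen {p : EuclideanSpace ℝ (Fin N) × ℝ × ℝ | 0 < p.2.1} :=
    isOpen_lt continuous_const (by fun_prop)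
  have hline : HasDerivAt (fun s : ℝ => ((X, t, z) : EuclideanSpace ℝ (Fin N) × ℝ × ℝ) + s • d)
      d 0 := by
    have h := ((hasDerivAt_id (0 : ℝ)).smul_const d).const_add (X, t, z)
    rwa [one_smul] at h
  have hf : HasFDerivAt (fun p => extKernel Q B a (p, (Y, ζ)))
      (fderivFst (extKernel Q B a) (X, t, z) (Y, ζ)) ((X, t, z) + (0 : ℝ) • d) := by
    rw [zero_smul, add_zero]
    exact hasFDerivAt_fderivFst hU (contDiffOn_extKernel hK ha) ht (Y, ζ)
  have h₁₂ : HasDerivAt (fun s : ℝ => extKernel Q B a ((X, t, z) + s • d, (Y, ζ)))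
      (extKernel Q B a ((X, t, z) + (0 : ℝ) • d, (Y, ζ)) * (m₁ + m₂)) 0 := (h₁.add h₂).exp
  have h₃ : HasDerivAt (fun s : ℝ => extKernel Q B a ((X, t, z) + s • d, (Y, ζ)))
      (fderivFst (extKernel Q B a) (X, t, z) (Y, ζ) d) 0 :=
    HasFDerivAt.comp_hasDerivAt (l := fun p => extKernel Q B a (p, (Y, ζ)))
      (f := fun s : ℝ => ((X, t, z) : EuclideanSpace ℝ (Fin N) × ℝ × ℝ) + s • d) (0 : ℝ) hf hline
  have e := h₃.unique h₁₂
  rw [zero_smul, add_zero] at e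
  rw [e, mul_comm]
  exact mul_lt_mul_of_pos_right (by linarith) (Real.exp_pos _)

end Kernels

/-! ### The extension semigroup as a parametric integral -/

section Semigroup

variable {N : ℕ}

/-- The datum `φ` times the density `ζ ^ a` of the Bessel measure. -/
noncomputable def weight (a : ℝ) (φ : EuclideanSpace ℝ (Fin N) × ℝ → ℝ)
    (q : EuclideanSpace ℝ (Fin N) × ℝ) : ℝ :=
  φ q * q.2 ^ a

/-- The semigroup without its constant factor, as a function of `(X, t, z)` extended evenly to
negative `z`. -/
noncomputable def potential (Q B : Matrix (Fin N) (Fin N) ℝ) (a : ℝ)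
    (φ : EuclideanSpace ℝ (Fin N) × ℝ → ℝ) (p : EuclideanSpace ℝ (Fin N) × ℝ × ℝ) : ℝ :=
  ∫ q, extKernel Q B a (p, q) * weight a φ q

variable {Q B : Matrix (Fin N) (Fin N) ℝ} {a : ℝ} {φ : EuclideanSpace ℝ (Fin N) × ℝ → ℝ}

lemma eq_zero_of_snd_nonpos (hφs : tsupport φ ⊆ {q | 0 < q.2})
    {q : EuclideanSpace ℝ (Fin N) × ℝ} (hq : q.2 ≤ 0) : φ q = 0 := by
  by_contra h
  exact absurd (hφs (subset_tsupport φ h)) (not_lt.2 hq)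

lemma continuous_weight (hφ : Continuous φ) (hφs : tsupport φ ⊆ {q | 0 < q.2}) :
    Continuous (weight a φ) := by
  refine continuous_iff_continuousAt.2 fun q => ?_
  by_cases hq : q ∈ tsupport φ
  · exact hφ.continuousAt.mul
      (continuousAt_snd.rpow_const (Or.inl (show (0 : ℝ) < q.2 from hφs hq).ne'))
  · have h0 : weight a φ =ᶠ[nhds q] fun _ => 0 := by
      filter_upwards [notMem_tsupport_iff_eventuallyEq.1 hq] with q' hq'
      simp [weight, hq']
    exact continuousAt_const.congr h0.symm

lemma hasCompactSupport_weight (hφc : HasCompactSupport φ) : HasCompactSupport (weight a φ) :=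
  HasCompactSupport.mul_right (f' := fun q : EuclideanSpace ℝ (Fin N) × ℝ => q.2 ^ a) hφc

lemma weight_nonneg (hφs : tsupport φ ⊆ {q | 0 < q.2}) (hφ0 : ∀ q, 0 ≤ φ q)
    (q : EuclideanSpace ℝ (Fin N) × ℝ) : 0 ≤ weight a φ q := by
  rcases le_or_gt q.2 0 with h | h
  · simp [weight, eq_zero_of_snd_nonpos hφs h]
  · exact mul_nonneg (hφ0 q) (Real.rpow_nonneg h.le a)

lemma snd_pos_of_weight_ne_zero (hφs : tsupport φ ⊆ {q | 0 < q.2})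
    {q : EuclideanSpace ℝ (Fin N) × ℝ} (hq : weight a φ q ≠ 0) : 0 < q.2 := by
  by_contra h
  exact hq (by simp [weight, eq_zero_of_snd_nonpos hφs (not_lt.1 h)])

lemma exists_weight_ne_zero (hφs : tsupport φ ⊆ {q | 0 < q.2}) (hφne : ∃ q, φ q ≠ 0) :
    ∃ q, weight a φ q ≠ 0 := by
  obtain ⟨q, hq⟩ := hφne
  have : 0 < q.2 := hφs (subset_tsupport φ hq)
  exact ⟨q, mul_ne_zero hq (Real.rpow_pos_of_pos this a).ne'⟩

lemma isOpen_positiveTime : IsOpen {p : EuclideanSpace ℝ (Fin N) × ℝ × ℝ | 0 < p.2.1} :=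
  isOpen_lt continuous_const (by fun_prop)

lemma continuous_extKernel (hK : ∀ t : ℝ, 0 < t → (covK Q B t).PosDef) (ha : -1 < a)
    {p : EuclideanSpace ℝ (Fin N) × ℝ × ℝ} (hp : 0 < p.2.1) :
    Continuous fun q => extKernel Q B a (p, q) :=
  (contDiffOn_extKernel hK ha).continuousOn.comp_continuous (by fun_prop)
    fun q => ⟨hp, mem_univ q⟩

lemma extSemigroup_eq (hK : ∀ t : ℝ, 0 < t → (covK Q B t).PosDef) (ha : -1 < a)
    (hφ : Continuous φ) (hφc : HasCompactSupport φ) (hφs : tsupport φ ⊆ {q | 0 < q.2})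
    (X : EuclideanSpace ℝ (Fin N)) {t z : ℝ} (ht : 0 < t) (hz : 0 ≤ z) :
    extSemigroup Q B a φ t X z = gaussConst N * potential Q B a φ (X, t, z) := by
  have hint : Integrable (fun q => extKernel Q B a ((X, t, z), q) * weight a φ q)
      ((volume : Measure (EuclideanSpace ℝ (Fin N))).prod (volume : Measure ℝ)) :=
    ((continuous_extKernel hK ha ht).mul
      (continuous_weight hφ hφs)).integrable_of_hasCompactSupport
        (hasCompactSupport_weight hφc).mul_left
  -- The inner integral vanishes for `ζ ≤ 0`, so the domain may be enlarged to the full space.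
  have hζ : ∀ ζ ∉ Ioi (0 : ℝ), ∫ Y : EuclideanSpace ℝ (Fin N),
      extKernel Q B a ((X, t, z), (Y, ζ)) * weight a φ (Y, ζ) = 0 := fun ζ hζ => by
    have : ∀ Y : EuclideanSpace ℝ (Fin N), weight a φ (Y, ζ) = 0 := fun Y => by
      simp [weight, eq_zero_of_snd_nonpos hφs (q := (Y, ζ)) (not_lt.1 hζ)]
    simp [this]
  rw [potential, Measure.volume_eq_prod, integral_prod_symm _ hint,
    ← setIntegral_eq_integral_of_forall_compl_eq_zero hζ, ← integral_const_mul, extSemigroup]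
  refine setIntegral_congr_fun measurableSet_Ioi fun ζ hζ => ?_
  rw [← integral_const_mul]
  refine integral_congr_ae (Filter.Eventually.of_forall fun Y => ?_)
  simp only [neumannG, sub_zero, weight, extKernel]
  rw [kernelP_eq ht (hK t ht), besselKernel_eq_exp ha hz hζ ht, Real.exp_add]
  ring

lemma potential_pos (hK : ∀ t : ℝ, 0 < t → (covK Q B t).PosDef) (ha : -1 < a)
    (hφ : Continuous φ) (hφc : HasCompactSupport φ) (hφs : tsupport φ ⊆ {q | 0 < q.2})
    (hφ0 : ∀ q, 0 ≤ φ q) (hφne : ∃ q, φ q ≠ 0)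
    {p : EuclideanSpace ℝ (Fin N) × ℝ × ℝ} (hp : 0 < p.2.1) : 0 < potential Q B a φ p := by
  obtain ⟨q, hq⟩ := exists_weight_ne_zero (a := a) hφs hφne
  exact Continuous.integral_pos_of_hasCompactSupport_nonneg_nonzero (x := q)
    ((continuous_extKernel hK ha hp).mul (continuous_weight hφ hφs))
    (hasCompactSupport_weight hφc).mul_left
    (fun q => mul_nonneg (Real.exp_pos _).le (weight_nonneg hφs hφ0 q))
    (mul_ne_zero (Real.exp_pos _).ne' hq)

/-- The Li-Yau inequality at a point, under the condition that makes the Bessel factor satisfy its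
pointwise inequality there. -/
lemma liYauAt_of_nonneg_or (hQ : Q.PosSemidef) (hK : ∀ t : ℝ, 0 < t → (covK Q B t).PosDef)
    (ha : -1 < a) (hφ : Continuous φ) (hφc : HasCompactSupport φ)
    (hφs : tsupport φ ⊆ {q | 0 < q.2}) (hφ0 : ∀ q, 0 ≤ φ q) (hφne : ∃ q, φ q ≠ 0)
    (X : EuclideanSpace ℝ (Fin N)) {t z : ℝ} (ht : 0 < t) (hz : 0 ≤ z) (haz : 0 ≤ a ∨ z = 0) :
    LiYauAt Q B a φ X t z := by
  have hw := continuous_weight (a := a) hφ hφs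
  have hwc := hasCompactSupport_weight (a := a) hφc
  have hP : 0 < potential Q B a φ (X, t, z) := potential_pos hK ha hφ hφc hφs hφ0 hφne ht
  set u : EuclideanSpace ℝ (Fin N) × ℝ × ℝ → ℝ :=
    fun p => Real.log (gaussConst N * potential Q B a φ p) with hu
  have hext : ∀ (X' : EuclideanSpace ℝ (Fin N)) (t' z' : ℝ), 0 < t' → 0 ≤ z' →
      Real.log (extSemigroup Q B a φ t' X' z')
        = u (X', t', z') := fun X' t' z' ht' hz' => by
    rw [hu, extSemigroup_eq hK ha hφ hφc hφs X' ht' hz']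
  set L := ∫ q, weight a φ q • fderivFst (extKernel Q B a) (X, t, z) q with hL
  have hder : HasFDerivAt (potential Q B a φ) L (X, t, z) :=
    hasFDerivAt_integral_mul_of_hasCompactSupport isOpen_positiveTime
      (contDiffOn_extKernel hK ha) hw hwc ht
  -- `ℓ` is the derivative of `u` in all variables jointly.
  set ℓ := (gaussConst N * potential Q B a φ (X, t, z))⁻¹ • (gaussConst N • L) with hℓ
  have hlog : HasFDerivAt u ℓ (X, t, z) :=
    (hder.const_mul (gaussConst N)).log (mul_pos (gaussConst_pos N) hP).ne'
  have hℓL : ∀ d, L d = potential Q B a φ (X, t, z) * ℓ d := fun d => by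
    have := (gaussConst_pos N).ne'
    simp only [hℓ, _root_.smul_apply, smul_eq_mul]
    field_simp
  have hX : HasFDerivAt (fun X' => Real.log (extSemigroup Q B a φ t X' z))
      (ℓ.comp (ContinuousLinearMap.inl ℝ _ _)) X := by
    simp only [hext _ t z ht hz]
    exact HasFDerivAt.comp (g := u) (f := fun X' => (X', t, z)) X hlog
      (hasFDerivAt_prodMk_left X (t, z))
  have hT : HasDerivAt (fun t' => Real.log (extSemigroup Q B a φ t' X z)) (ℓ (0, 1, 0)) t := by
    have hc : HasDerivAt (fun t' : ℝ => (X, t', z))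
        ((0 : EuclideanSpace ℝ (Fin N)), (1 : ℝ), (0 : ℝ)) t :=
      (hasDerivAt_const t X).prodMk ((hasDerivAt_id t).prodMk (hasDerivAt_const t z))
    refine (HasFDerivAt.comp_hasDerivAt (l := u) t hlog hc).congr_of_eventuallyEq ?_
    filter_upwards [Ioi_mem_nhds ht] with t' ht'
    exact hext X t' z ht' hz
  have hZ : HasDerivWithinAt (fun z' => Real.log (extSemigroup Q B a φ t X z')) (ℓ (0, 0, 1))
      (Ici 0) z := by
    have hc : HasDerivAt (fun z' : ℝ => (X, t, z'))
        ((0 : EuclideanSpace ℝ (Fin N)), (0 : ℝ), (1 : ℝ)) z :=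
      (hasDerivAt_const z X).prodMk ((hasDerivAt_const z t).prodMk (hasDerivAt_id z))
    exact (HasFDerivAt.comp_hasDerivAt (l := u) z hlog hc).hasDerivWithinAt.congr
      (fun z' hz' => hext X t z' ht hz') (hext X t z ht hz)
  refine ⟨?_, hX.differentiableAt, hZ.differentiableWithinAt, hT.differentiableAt, ?_⟩
  · rw [extSemigroup_eq hK ha hφ hφc hφs X ht hz]
    exact mul_pos (gaussConst_pos N) hP
  simp only
  rw [hT.deriv, hZ.derivWithin (uniqueDiffOn_Ici 0 z hz)]
  set v := gradient (fun X' => Real.log (extSemigroup Q B a φ t X' z)) X with hv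
  have hgrad : ∀ h, inner ℝ v h = ℓ (h, 0, 0) := fun h => by
    rw [hv, gradient, InnerProductSpace.toDual_symm_apply, hX.fderiv]
    rfl
  rw [← actCLM_apply, ← actCLM_apply]
  set b := ℓ (0, 0, 1) with hb
  -- The vector and the number at which the pointwise inequality is linearized are the spatial
  -- derivatives of `u` itself; this replaces the Cauchy-Schwarz inequality.
  have hmain := integral_fderivFst_lt (μ := volume) isOpen_positiveTime
    (contDiffOn_extKernel hK ha) hw hwc (weight_nonneg hφs hφ0)
    (exists_weight_ne_zero hφs hφne) (p := (X, t, z)) ht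
    ((2 : ℝ) • actCLM N Q v + actCLM N B X, -1, 2 * b) _
    fun q hq => fderivFst_extKernel_lt hQ hK ha haz ht
      (snd_pos_of_weight_ne_zero hφs hq).ne' X q.1 v b
  rw [← hL, hℓL, mul_comm, ← potential] at hmain
  have hlt := lt_of_mul_lt_mul_right hmain hP.le
  have hsplit : (((2 : ℝ) • actCLM N Q v + actCLM N B X, -1, 2 * b) :
      EuclideanSpace ℝ (Fin N) × ℝ × ℝ) = ((2 : ℝ) • actCLM N Q v + actCLM N B X, 0, 0)
        + ((-1 : ℝ) • (0, 1, 0) + (2 * b) • (0, 0, 1)) := by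
    simp
  rw [hsplit, map_add, map_add, map_smul, map_smul, ← hgrad, inner_add_right,
    real_inner_smul_right, ← hb, smul_eq_mul, smul_eq_mul] at hlt
  rw [real_inner_comm v, real_inner_comm v]
  rw [real_inner_comm v] at hlt
  linarith

end Semigroup

end ExtensionSemigroup

theorem mainTheorem2 (N : ℕ) (hN : 2 ≤ N) (Q B : Matrix (Fin N) (Fin N) ℝ)
    (hQ : Q.PosSemidef)
    (hK : ∀ t : ℝ, 0 < t → (ExtensionSemigroup.covK Q B t).PosDef)
    (φ : EuclideanSpace ℝ (Fin N) × ℝ → ℝ)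
    (hφ_smooth : ContDiff ℝ ∞ φ)
    (hφ_cpt : HasCompactSupport φ)
    (hφ_supp : tsupport φ ⊆ {q | 0 < q.2})
    (hφ_nonneg : ∀ q, 0 ≤ φ q)
    (hφ_ne : ∃ q, φ q ≠ 0) :
    (∀ a : ℝ, 0 ≤ a → ∀ (X : EuclideanSpace ℝ (Fin N)) (t z : ℝ), 0 < t → 0 < z →
      ExtensionSemigroup.LiYauAt Q B a φ X t z) ∧
    (∀ a : ℝ, -1 < a → ∀ (X : EuclideanSpace ℝ (Fin N)) (t : ℝ), 0 < t →
      ExtensionSemigroup.LiYauAt Q B a φ X t 0) :=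
  ⟨fun _ ha X _ _ ht hz => ExtensionSemigroup.liYauAt_of_nonneg_or hQ hK (by linarith)
      hφ_smooth.continuous hφ_cpt hφ_supp hφ_nonneg hφ_ne X ht hz.le (Or.inl ha),
    fun _ ha X _ ht => ExtensionSemigroup.liYauAt_of_nonneg_or hQ hK ha
      hφ_smooth.continuous hφ_cpt hφ_supp hφ_nonneg hφ_ne X ht le_rfl (Or.inr rfl)⟩
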